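/- Let $m\ge 2$ and $\kappa\in(0,1)$, and let $d>0$. There exists $\varepsilon>0$, depending only on $m$, $\kappa$ and $d$, such that the following holds for every $n\ge 1$, every bounded convex $C^2$ domain $\Omega\subset\mathbb{R}^m$ with $\operatorname{diam}\Omega\le d$, and every $T>0$. Let $\mathbb{R}^{m+n}_n$ be $\mathbb{R}^m\times\mathbb{R}^n$ with the metric $\langle v,w\rangle=\sum_{i=1}^m v^iw^i-\sum_{\gamma=m+1}^{m+n}v^\gamma w^\gamma$. Let $u:\overline\Omega\times[0,T]\to\mathbb{R}^n$ be a spacelike graphic mean curvature flow in $\mathbb{R}^{m+n}_n$: that is, $u$ is smooth on $\Omega\times(0,T)$ and $C^1$ on $\overline\Omega\times[0,T]$; for each $t\in[0,T]$ the graph of $u(\cdot,t)$ over $\Omega$ is spacelike, i.e. its induced metric $g(Du)=I-Du^{T}Du$ is positive definite ($D$ is the derivative in $x\in\mathbb{R}^m$ only); and $$\frac{\partial u}{\partial t}=g^{ij}(Du)\,\frac{\partial^2u}{\partial x^i\partial x^j}\quad\text{on }\Omega\times(0,T),$$ where $(g^{ij})$ is the inverse of $g$. Let $\phi:\overline\Omega\times[0,T]\to\mathbb{R}^n$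 be of parabolic class $C^2$, i.e. $\phi$, $D\phi$, $D^2\phi$ and $\partial\phi/\partial t$ exist and are continuous on $\overline\Omega\times[0,T]$, and suppose that $u(x,t)=\phi(x,t)$ whenever $x\in\partial\Omega$ or $t=0$. Write $|||A|||=\sup_{|v|=1}|Av|$ for linear maps $A:\mathbb{R}^m\to\mathbb{R}^n$ and $|||B|||=\sup_{|v|=1}|B(v,v)|$ for bilinear maps $B:\mathbb{R}^m\times\mathbb{R}^m\to\mathbb{R}^n$. If the parabolic $C^2$ norm of $\phi$ satisfies $$\sup_{\overline\Omega\times[0,T]}|\phi|+\sup_{\overline\Omega\times[0,T]}|||D\phi|||+\sup_{\overline\Omega\times[0,T]}|||D^2\phi|||+\sup_{\overline\Omega\times[0,T]}\left|\frac{\partial\phi}{\partial t}\right|<\varepsilon,$$ then $$\sup_{\Omega}|||Du(\cdot,t)|||^2<1-\kappa\qquad\text{for all }t\in[0,T].$$ -/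

import Mathlib

open Set Topology
open scoped ENNReal ContDiff Matrix

/-- The boundary of `Ω` is of class `C²`: near each boundary point, `Ω` is the negativity set of a
`C²` function with non-vanishing differential at that point. -/
def HasC2Boundary {m : ℕ} (Ω : Set (EuclideanSpace ℝ (Fin m))) : Prop :=
  ∀ p ∈ frontier Ω, ∃ U : Set (EuclideanSpace ℝ (Fin m)), IsOpen U ∧ p ∈ U ∧
    ∃ ρ : EuclideanSpace ℝ (Fin m) → ℝ, ContDiffOn ℝ 2 ρ U ∧ fderiv ℝ ρ p ≠ 0 ∧
      Ω ∩ U = {x ∈ U | ρ x < 0}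

/-- A bounded, convex, `C²` domain (non-empty open set; connected because it is convex). -/
structure IsBoundedConvexC2Domain {m : ℕ} (Ω : Set (EuclideanSpace ℝ (Fin m))) : Prop where
  isOpen : IsOpen Ω
  nonempty : Ω.Nonempty
  convex : Convex ℝ Ω
  isBounded : Bornology.IsBounded Ω
  c2Boundary : HasC2Boundary Ω

/-- The closed cylinder `Ω̄ × [0, T]`. -/
def closedCylinder {m : ℕ} (Ω : Set (EuclideanSpace ℝ (Fin m))) (T : ℝ) :
    Set (EuclideanSpace ℝ (Fin m) × ℝ) :=
  closure Ω ×ˢ Icc 0 T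

section Derivatives

variable {m n : ℕ} (Ω : Set (EuclideanSpace ℝ (Fin m))) (T : ℝ)
  (u : EuclideanSpace ℝ (Fin m) → ℝ → EuclideanSpace ℝ (Fin n))

/-- The space derivative `Du(x, t)`, taken within `Ω̄`, so that it makes sense up to the boundary.
On the open set `Ω` it is the ordinary derivative. -/
noncomputable def spaceDeriv (x : EuclideanSpace ℝ (Fin m)) (t : ℝ) :
    EuclideanSpace ℝ (Fin m) →L[ℝ] EuclideanSpace ℝ (Fin n) :=
  fderivWithin ℝ (fun y => u y t) (closure Ω) x

/-- The second space derivative `D²u(x, t)`, taken within `Ω̄`. -/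
noncomputable def spaceDeriv2 (x : EuclideanSpace ℝ (Fin m)) (t : ℝ) :
    EuclideanSpace ℝ (Fin m) →L[ℝ] EuclideanSpace ℝ (Fin m) →L[ℝ] EuclideanSpace ℝ (Fin n) :=
  fderivWithin ℝ (fun y => spaceDeriv Ω u y t) (closure Ω) x

/-- The time derivative `∂u/∂t (x, t)`, one-sided at the end points of `[0, T]`. -/
noncomputable def timeDeriv (x : EuclideanSpace ℝ (Fin m)) (t : ℝ) : EuclideanSpace ℝ (Fin n) :=
  derivWithin (fun s => u x s) (Icc 0 T) t

end Derivatives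

section Norms

variable {m n : ℕ}

/-- `|||A||| = sup_{|v| = 1} |A v|`. -/
noncomputable def tripleNorm (A : EuclideanSpace ℝ (Fin m) →L[ℝ] EuclideanSpace ℝ (Fin n)) :
    ℝ≥0∞ :=
  ⨆ v ∈ Metric.sphere (0 : EuclideanSpace ℝ (Fin m)) 1, ‖A v‖ₑ

/-- `|||B||| = sup_{|v| = 1} |B(v, v)|`. -/
noncomputable def tripleNorm2
    (B : EuclideanSpace ℝ (Fin m) →L[ℝ] EuclideanSpace ℝ (Fin m) →L[ℝ] EuclideanSpace ℝ (Fin n)) :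
    ℝ≥0∞ :=
  ⨆ v ∈ Metric.sphere (0 : EuclideanSpace ℝ (Fin m)) 1, ‖B v v‖ₑ

end Norms

/-- `φ` is of parabolic class `C²` on `Ω̄ × [0, T]`: the derivatives `Dφ`, `D²φ` and `∂φ/∂t` exist,
and they and `φ` are continuous on `Ω̄ × [0, T]`. -/
structure IsParabolicC2 {m n : ℕ} (Ω : Set (EuclideanSpace ℝ (Fin m))) (T : ℝ)
    (φ : EuclideanSpace ℝ (Fin m) → ℝ → EuclideanSpace ℝ (Fin n)) : Prop where
  contDiff_space : ∀ t ∈ Icc 0 T, ContDiffOn ℝ 2 (fun x => φ x t) (closure Ω)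
  differentiable_time : ∀ x ∈ closure Ω, DifferentiableOn ℝ (fun t => φ x t) (Icc 0 T)
  continuous : ContinuousOn (fun p => φ p.1 p.2) (closedCylinder Ω T)
  continuous_spaceDeriv : ContinuousOn (fun p => spaceDeriv Ω φ p.1 p.2) (closedCylinder Ω T)
  continuous_spaceDeriv2 : ContinuousOn (fun p => spaceDeriv2 Ω φ p.1 p.2) (closedCylinder Ω T)
  continuous_timeDeriv : ContinuousOn (fun p => timeDeriv T φ p.1 p.2) (closedCylinder Ω T)

/-- The parabolic `C²` norm `sup |φ| + sup |||Dφ||| + sup |||D²φ||| + sup |∂φ/∂t|`, the suprema being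
over `Ω̄ × [0, T]`. -/
noncomputable def parabolicC2Norm {m n : ℕ} (Ω : Set (EuclideanSpace ℝ (Fin m))) (T : ℝ)
    (φ : EuclideanSpace ℝ (Fin m) → ℝ → EuclideanSpace ℝ (Fin n)) : ℝ≥0∞ :=
  (⨆ p ∈ closedCylinder Ω T, ‖φ p.1 p.2‖ₑ)
    + (⨆ p ∈ closedCylinder Ω T, tripleNorm (spaceDeriv Ω φ p.1 p.2))
    + (⨆ p ∈ closedCylinder Ω T, tripleNorm2 (spaceDeriv2 Ω φ p.1 p.2))
    + (⨆ p ∈ closedCylinder Ω T, ‖timeDeriv T φ p.1 p.2‖ₑ)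

/-- The metric `⟨v, w⟩ = ∑_{i ≤ m} vⁱ wⁱ - ∑_{γ > m} v^γ w^γ` of the semi-Euclidean space
`ℝ^{m+n}_n = ℝ^m × ℝ^n`. -/
noncomputable def semiEuclideanForm {m n : ℕ}
    (v w : EuclideanSpace ℝ (Fin m) × EuclideanSpace ℝ (Fin n)) : ℝ :=
  inner ℝ v.1 w.1 - inner ℝ v.2 w.2

/-- The matrix `(g_{ij})` of the metric induced on a graph with derivative `A`: the entries are the
products of the tangent vectors `(e_i, A e_i)`, that is, `g = I - Aᵀ A`. -/
noncomputable def inducedMetric {m n : ℕ}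
    (A : EuclideanSpace ℝ (Fin m) →L[ℝ] EuclideanSpace ℝ (Fin n)) : Matrix (Fin m) (Fin m) ℝ :=
  Matrix.of fun i j => semiEuclideanForm
    (EuclideanSpace.single i (1 : ℝ), A (EuclideanSpace.single i (1 : ℝ)))
    (EuclideanSpace.single j (1 : ℝ), A (EuclideanSpace.single j (1 : ℝ)))

/-- `u` is a spacelike graphic mean curvature flow in `ℝ^{m+n}_n` over `Ω` for the times `[0, T]`:
it is smooth on `Ω × (0, T)` and `C¹` on the closure, the graphs of `u(·, t)`, `t ∈ [0, T]`, over `Ω`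
are spacelike, and `∂u/∂t = g^{ij}(Du) ∂²u/∂xⁱ∂xʲ` on `Ω × (0, T)`. -/
structure IsSpacelikeGraphicMCF {m n : ℕ} (Ω : Set (EuclideanSpace ℝ (Fin m))) (T : ℝ)
    (u : EuclideanSpace ℝ (Fin m) → ℝ → EuclideanSpace ℝ (Fin n)) : Prop where
  smooth : ContDiffOn ℝ ∞ (fun p : EuclideanSpace ℝ (Fin m) × ℝ => u p.1 p.2) (Ω ×ˢ Ioo 0 T)
  c1_closure : ContDiffOn ℝ 1 (fun p : EuclideanSpace ℝ (Fin m) × ℝ => u p.1 p.2)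
    (closedCylinder Ω T)
  spacelike : ∀ x ∈ Ω, ∀ t ∈ Icc 0 T, (inducedMetric (spaceDeriv Ω u x t)).PosDef
  flow : ∀ x ∈ Ω, ∀ t ∈ Ioo 0 T,
    timeDeriv T u x t = ∑ i, ∑ j, (inducedMetric (spaceDeriv Ω u x t))⁻¹ i j •
      spaceDeriv2 Ω u x t (EuclideanSpace.single i (1 : ℝ)) (EuclideanSpace.single j (1 : ℝ))

/-! As long as `‖Du‖` stays below a threshold of order `1/m²`, the metric `g` is close to the
identity and the flow is a uniformly parabolic system whose components share the same scalar
coefficients `g^{ij}`. In that regime the smallness of `φ` improves the gradient bound, and a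
continuity argument in time closes the loop.

Boundary. For a unit vector `w`, the scalar `⟪w, u - φ⟫` is compared with the concave barrier `K ℓ
(2d - ℓ)`, where `ℓ` is the distance to a supporting hyperplane of `Ω` at a boundary point. This
gives `|u - φ| ≤ C d ε |y - x₀|` (`norm_sub_le_of_barrier`).

Interior. The resulting Lipschitz bound on the parabolic boundary is propagated by a two-point
maximum principle for `|u(x) - u(y)|² - L²|x - y|²` (`norm_sub_le_of_parabolic_boundary`). Writing
`g⁻¹ = R²` with `R` symmetric, the points `x` and `y` are moved along the columns of their
respective `R`. The bad term `L²|R(x) - R(y)|²` is dominated by the good term `|Du(x)R(x) -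
Du(y)R(y)|²`, because `R` is Lipschitz in `Du` and `L` is small (`sum_norm_metricFrame_sub_sq_le`).

Continuity. At a first time when the gradient reaches `δ`, the improved bound `L < δ` holds at all
earlier positive times, hence in the limit: a contradiction (`norm_spaceDeriv_lt`). -/

/-! ### Matrix estimates for the inverse square root of the induced metric, in the Frobenius norm.
-/

section LinearAlgebra

open scoped Matrix.Norms.Frobenius MatrixOrder

variable {k l m n : ℕ}

theorem frobenius_norm_sq_eq_sum (X : Matrix (Fin k) (Fin l) ℝ) :
    ‖X‖ ^ 2 = ∑ i, ∑ j, X i j ^ 2 := by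
  rw [Matrix.frobenius_norm_def, ← Real.sqrt_eq_rpow, Real.sq_sqrt (by positivity)]
  simp

theorem frobenius_norm_sq_eq_trace (X : Matrix (Fin k) (Fin l) ℝ) :
    ‖X‖ ^ 2 = (X * Xᵀ).trace := by
  rw [frobenius_norm_sq_eq_sum]
  simp [Matrix.trace, Matrix.mul_apply, sq]

theorem frobenius_norm_one_le : ‖(1 : Matrix (Fin m) (Fin m) ℝ)‖ ≤ m := by
  refine le_of_sq_le_sq ?_ (by positivity)
  rw [frobenius_norm_sq_eq_trace]
  have : (m : ℝ) ≤ (m : ℝ) ^ 2 := by exact_mod_cast Nat.le_self_pow two_ne_zero m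
  simpa using this

/-- Expanding the square gives `‖X‖² + 2 tr(X r Xᵀ) + ‖X r‖²`, and the last two terms are
nonnegative. -/
theorem Matrix.PosSemidef.frobenius_norm_le_mul_one_add {r : Matrix (Fin m) (Fin m) ℝ}
    (hr : r.PosSemidef) (X : Matrix (Fin k) (Fin m) ℝ) : ‖X‖ ≤ ‖X * (1 + r)‖ := by
  refine le_of_sq_le_sq ?_ (by positivity)
  have ht : rᵀ = r := by simpa [Matrix.IsHermitian] using hr.isHermitian
  have h1 : 0 ≤ (X * r * Xᵀ).trace := by
    simpa using (hr.mul_mul_conjTranspose_same X).trace_nonneg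
  have h2 : ‖X * (1 + r)‖ ^ 2 = ‖X‖ ^ 2 + 2 * (X * r * Xᵀ).trace + ‖X * r‖ ^ 2 := by
    simp only [frobenius_norm_sq_eq_trace, Matrix.mul_add, Matrix.mul_one, Matrix.transpose_add,
      Matrix.transpose_mul, ht, Matrix.add_mul, Matrix.trace_add, Matrix.mul_assoc]
    ring
  nlinarith [sq_nonneg ‖X * r‖]

/-- The Jacobian matrix of a linear map between Euclidean spaces. -/
noncomputable def jacobianMatrix (A : EuclideanSpace ℝ (Fin m) →L[ℝ] EuclideanSpace ℝ (Fin n)) :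
    Matrix (Fin n) (Fin m) ℝ :=
  Matrix.of fun i j => A (EuclideanSpace.single j 1) i

theorem map_eq_jacobianMatrix_mulVec
    (A : EuclideanSpace ℝ (Fin m) →L[ℝ] EuclideanSpace ℝ (Fin n)) (v : EuclideanSpace ℝ (Fin m))
    (i : Fin n) : A v i = ∑ j, jacobianMatrix A i j * v j := by
  have hv : v = ∑ j, v j • EuclideanSpace.single j (1 : ℝ) := by
    ext i; simp [Pi.single_apply]
  conv_lhs => rw [hv]
  simp [jacobianMatrix, mul_comm]

theorem inducedMetric_eq (A : EuclideanSpace ℝ (Fin m) →L[ℝ] EuclideanSpace ℝ (Fin n)) :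
    inducedMetric A = 1 - (jacobianMatrix A)ᵀ * jacobianMatrix A := by
  ext i j
  simp [inducedMetric, semiEuclideanForm, jacobianMatrix, Matrix.mul_apply, PiLp.inner_apply,
    Matrix.one_apply, mul_comm, eq_comm]

theorem frobenius_norm_jacobianMatrix_le
    (A : EuclideanSpace ℝ (Fin m) →L[ℝ] EuclideanSpace ℝ (Fin n)) :
    ‖jacobianMatrix A‖ ≤ m * ‖A‖ := by
  refine le_of_sq_le_sq ?_ (by positivity)
  rw [frobenius_norm_sq_eq_sum, Finset.sum_comm]
  have h (j : Fin m) : ∑ i, jacobianMatrix A i j ^ 2 ≤ ‖A‖ ^ 2 := by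
    have h1 : ∑ i, jacobianMatrix A i j ^ 2 = ‖A (EuclideanSpace.single j 1)‖ ^ 2 := by
      rw [EuclideanSpace.norm_sq_eq]
      simp [jacobianMatrix]
    rw [h1]
    have := A.le_opNorm (EuclideanSpace.single j (1 : ℝ))
    gcongr
    simpa using this
  have hm : (m : ℝ) ≤ (m : ℝ) ^ 2 := by exact_mod_cast Nat.le_self_pow two_ne_zero m
  calc ∑ j, ∑ i, jacobianMatrix A i j ^ 2 ≤ ∑ _j : Fin m, ‖A‖ ^ 2 := Finset.sum_le_sum fun j _ => h j
    _ = m * ‖A‖ ^ 2 := by simp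
    _ ≤ (m * ‖A‖) ^ 2 := by rw [mul_pow]; gcongr

/-- The positive square root of the metric induced on a graph. -/
noncomputable def metricRoot (A : EuclideanSpace ℝ (Fin m) →L[ℝ] EuclideanSpace ℝ (Fin n)) :
    Matrix (Fin m) (Fin m) ℝ :=
  CFC.sqrt (inducedMetric A)

theorem metricRoot_posSemidef (A : EuclideanSpace ℝ (Fin m) →L[ℝ] EuclideanSpace ℝ (Fin n)) :
    (metricRoot A).PosSemidef :=
  Matrix.nonneg_iff_posSemidef.1 (CFC.sqrt_nonneg _)

theorem metricRoot_transpose (A : EuclideanSpace ℝ (Fin m) →L[ℝ] EuclideanSpace ℝ (Fin n)) :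
    (metricRoot A)ᵀ = metricRoot A := by
  simpa [Matrix.IsHermitian] using (metricRoot_posSemidef A).isHermitian

theorem inducedMetric_posSemidef {A : EuclideanSpace ℝ (Fin m) →L[ℝ] EuclideanSpace ℝ (Fin n)}
    (hA : ‖A‖ ≤ 1) : (inducedMetric A).PosSemidef := by
  rw [inducedMetric_eq]
  refine Matrix.PosSemidef.of_dotProduct_mulVec_nonneg ?_ fun v => ?_
  · simp [Matrix.IsHermitian, Matrix.transpose_sub, Matrix.transpose_mul]
  · have h := A.le_of_opNorm_le hA (WithLp.toLp 2 v)
    have h2 : ‖A (WithLp.toLp 2 v)‖ ^ 2 ≤ ‖(WithLp.toLp 2 v : EuclideanSpace ℝ (Fin m))‖ ^ 2 := by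
      gcongr; simpa using h
    rw [EuclideanSpace.norm_sq_eq, EuclideanSpace.norm_sq_eq] at h2
    have h3 : (jacobianMatrix A).mulVec v = fun i => A (WithLp.toLp 2 v) i := by
      ext i; rw [map_eq_jacobianMatrix_mulVec]; rfl
    rw [Matrix.sub_mulVec, ← Matrix.mulVec_mulVec, dotProduct_sub, Matrix.mulVec_transpose,
      dotProduct_comm _ (Matrix.vecMul _ _), ← Matrix.dotProduct_mulVec, h3]
    simp only [star_trivial, Matrix.one_mulVec, dotProduct, sub_nonneg]
    simpa [sq, h3] using h2

theorem metricRoot_mul_self {A : EuclideanSpace ℝ (Fin m) →L[ℝ] EuclideanSpace ℝ (Fin n)}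
    (hA : ‖A‖ ≤ 1) :
    metricRoot A * metricRoot A = 1 - (jacobianMatrix A)ᵀ * jacobianMatrix A := by
  rw [← inducedMetric_eq]
  exact CFC.sqrt_mul_sqrt_self _ (Matrix.nonneg_iff_posSemidef.2 (inducedMetric_posSemidef hA))

/-- With `r` the root and `J` the Jacobian, `(1 - r)(1 + r) = 1 - r² = JᵀJ`, and the factor `1 + r`
only increases the norm. The root is thus quadratically close to the identity. -/
theorem norm_one_sub_metricRoot_le {A : EuclideanSpace ℝ (Fin m) →L[ℝ] EuclideanSpace ℝ (Fin n)}
    (hA : ‖A‖ ≤ 1) : ‖1 - metricRoot A‖ ≤ ‖jacobianMatrix A‖ ^ 2 := by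
  refine ((metricRoot_posSemidef A).frobenius_norm_le_mul_one_add _).trans ?_
  have : (1 - metricRoot A) * (1 + metricRoot A) = (jacobianMatrix A)ᵀ * jacobianMatrix A := by
    have h := metricRoot_mul_self hA
    have : (1 - metricRoot A) * (1 + metricRoot A) = 1 - metricRoot A * metricRoot A := by
      noncomm_ring
    rw [this, h]; abel
  rw [this, sq]
  refine (Matrix.frobenius_norm_mul _ _).trans ?_
  rw [Matrix.frobenius_norm_transpose]

/-- The smallness threshold for the gradient in dimension `m`. -/
noncomputable def gradientThreshold (m : ℕ) : ℝ := 1 / (16 * (m : ℝ) ^ 2)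

theorem gradientThreshold_pos (hm : 1 ≤ m) : 0 < gradientThreshold m := by
  have : (0 : ℝ) < m := by exact_mod_cast hm
  unfold gradientThreshold; positivity

theorem gradientThreshold_le (hm : 1 ≤ m) : gradientThreshold m ≤ 1 / 16 := by
  have : (1 : ℝ) ≤ m := by exact_mod_cast hm
  unfold gradientThreshold
  gcongr
  nlinarith

/-- One factor `m` in the threshold pays for passing from operator to Frobenius norm. The other is
kept on the left, to absorb the factor `m` in the bounds on `(metricRoot A)⁻¹`. -/
theorem norm_jacobianMatrix_le_of_threshold (hm : 1 ≤ m)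
    {A : EuclideanSpace ℝ (Fin m) →L[ℝ] EuclideanSpace ℝ (Fin n)}
    (hA : ‖A‖ ≤ gradientThreshold m) : m * ‖jacobianMatrix A‖ ≤ 1 / 16 := by
  have h0 : (0 : ℝ) < m := by exact_mod_cast hm
  calc m * ‖jacobianMatrix A‖ ≤ m * (m * gradientThreshold m) := by
        gcongr
        exact (frobenius_norm_jacobianMatrix_le A).trans (by gcongr)
    _ = 1 / 16 := by unfold gradientThreshold; field_simp

theorem norm_one_sub_metricRoot_le_of_threshold (hm : 1 ≤ m)
    {A : EuclideanSpace ℝ (Fin m) →L[ℝ] EuclideanSpace ℝ (Fin n)}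
    (hA : ‖A‖ ≤ gradientThreshold m) : m * ‖1 - metricRoot A‖ ≤ 1 / 256 := by
  have h1 := norm_one_sub_metricRoot_le (hA.trans ((gradientThreshold_le hm).trans (by norm_num)))
  have h2 := norm_jacobianMatrix_le_of_threshold hm hA
  have h3 : (1 : ℝ) ≤ m := by exact_mod_cast hm
  have h4 : ‖jacobianMatrix A‖ ≤ 1 / 16 := by nlinarith [norm_nonneg (jacobianMatrix A)]
  calc m * ‖1 - metricRoot A‖ ≤ m * ‖jacobianMatrix A‖ ^ 2 := by gcongr
    _ = (m * ‖jacobianMatrix A‖) * ‖jacobianMatrix A‖ := by ring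
    _ ≤ 1 / 16 * (1 / 16) := by gcongr
    _ = 1 / 256 := by norm_num

theorem metricRoot_mul_inv (hm : 1 ≤ m)
    {A : EuclideanSpace ℝ (Fin m) →L[ℝ] EuclideanSpace ℝ (Fin n)}
    (hA : ‖A‖ ≤ gradientThreshold m) : metricRoot A * (metricRoot A)⁻¹ = 1 := by
  have h1 := norm_one_sub_metricRoot_le_of_threshold hm hA
  have h3 : (1 : ℝ) ≤ m := by exact_mod_cast hm
  have h4 : ‖1 - metricRoot A‖ < 1 := by nlinarith [norm_nonneg (1 - metricRoot A)]
  have h5 : IsUnit (metricRoot A) := by simpa using isUnit_one_sub_of_norm_lt_one h4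
  exact Matrix.mul_nonsing_inv _ ((Matrix.isUnit_iff_isUnit_det _).1 h5)

theorem inv_metricRoot_mul_self (hm : 1 ≤ m)
    {A : EuclideanSpace ℝ (Fin m) →L[ℝ] EuclideanSpace ℝ (Fin n)}
    (hA : ‖A‖ ≤ gradientThreshold m) :
    (metricRoot A)⁻¹ * (metricRoot A)⁻¹ = (inducedMetric A)⁻¹ := by
  have h1 := metricRoot_mul_self (hA.trans ((gradientThreshold_le hm).trans (by norm_num)))
  rw [← inducedMetric_eq] at h1
  rw [← h1, Matrix.mul_inv_rev]

/-- Both bounds come from `R - 1 = (1 - r) R`: since `‖1‖ ≤ m`, it gives `‖R‖ ≤ m + ‖R‖ / 256`, and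
this bound on `‖R‖` is then fed back into the identity. -/
theorem norm_inv_metricRoot_le (hm : 1 ≤ m)
    {A : EuclideanSpace ℝ (Fin m) →L[ℝ] EuclideanSpace ℝ (Fin n)}
    (hA : ‖A‖ ≤ gradientThreshold m) :
    ‖(metricRoot A)⁻¹‖ ≤ 11 / 10 * m ∧ ‖(metricRoot A)⁻¹ - 1‖ ≤ 1 / 2 := by
  have h1 := norm_one_sub_metricRoot_le_of_threshold hm hA
  have h3 : (1 : ℝ) ≤ m := by exact_mod_cast hm
  set R := (metricRoot A)⁻¹ with hR
  have h4 : ‖1 - metricRoot A‖ ≤ 1 / 256 := by nlinarith [norm_nonneg (1 - metricRoot A)]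
  have h5 : R - 1 = (1 - metricRoot A) * R := by
    rw [sub_mul, metricRoot_mul_inv hm hA, one_mul]
  have h6 : ‖R - 1‖ ≤ ‖1 - metricRoot A‖ * ‖R‖ := h5 ▸ Matrix.frobenius_norm_mul _ _
  have h7 : ‖R‖ ≤ ‖R - 1‖ + m := by
    have := norm_add_le (R - 1) 1
    rw [sub_add_cancel] at this
    linarith [frobenius_norm_one_le (m := m)]
  have h8 : ‖R‖ ≤ 11 / 10 * m := by nlinarith [norm_nonneg R]
  refine ⟨h8, ?_⟩
  nlinarith [norm_nonneg (1 - metricRoot A)]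

theorem norm_inv_metricRoot_sub_le (hm : 1 ≤ m)
    {A B : EuclideanSpace ℝ (Fin m) →L[ℝ] EuclideanSpace ℝ (Fin n)}
    (hA : ‖A‖ ≤ gradientThreshold m) (hB : ‖B‖ ≤ gradientThreshold m) :
    ‖(metricRoot A)⁻¹ - (metricRoot B)⁻¹‖ ≤ m * ‖jacobianMatrix A - jacobianMatrix B‖ := by
  have h3 : (1 : ℝ) ≤ m := by exact_mod_cast hm
  set a := 1 - metricRoot A with ha
  set b := 1 - metricRoot B with hb
  set X := jacobianMatrix A
  set Y := jacobianMatrix B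
  have h1 := norm_one_sub_metricRoot_le_of_threshold hm hA
  have h2 := norm_one_sub_metricRoot_le_of_threshold hm hB
  have hX := norm_jacobianMatrix_le_of_threshold hm hA
  have hY := norm_jacobianMatrix_le_of_threshold hm hB
  have ha1 : ‖a‖ ≤ 1 / 256 := by nlinarith [norm_nonneg a]
  have hb1 : ‖b‖ ≤ 1 / 256 := by nlinarith [norm_nonneg b]
  have hle : gradientThreshold m ≤ 1 := (gradientThreshold_le hm).trans (by norm_num)
  -- `a` solves `2a - a² = XᵀX`, and `b` likewise with `Y`. Subtracting leaves quadratic terms small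
  -- enough to be absorbed on the left.
  have key : (2 : ℝ) • (a - b) = (Xᵀ * (X - Y) + (X - Y)ᵀ * Y) + (a * (a - b) + (a - b) * b) := by
    have e1 : (2 : ℝ) • (a - b) - (a * (a - b) + (a - b) * b)
        = metricRoot B * metricRoot B - metricRoot A * metricRoot A := by
      rw [ha, hb, two_smul]; noncomm_ring
    have e2 : Xᵀ * (X - Y) + (X - Y)ᵀ * Y = Xᵀ * X - Yᵀ * Y := by
      rw [Matrix.transpose_sub, Matrix.mul_sub, Matrix.sub_mul]; abel
    rw [metricRoot_mul_self (hA.trans hle), metricRoot_mul_self (hB.trans hle)] at e1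
    rw [e2, ← sub_eq_iff_eq_add, e1]; abel
  have k1 : ‖Xᵀ * (X - Y) + (X - Y)ᵀ * Y‖ ≤ (‖X‖ + ‖Y‖) * ‖X - Y‖ := by
    refine (norm_add_le _ _).trans ?_
    have e1 := Matrix.frobenius_norm_mul Xᵀ (X - Y)
    have e2 := Matrix.frobenius_norm_mul (X - Y)ᵀ Y
    rw [Matrix.frobenius_norm_transpose] at e1 e2
    linarith
  have k2 : ‖a * (a - b) + (a - b) * b‖ ≤ (‖a‖ + ‖b‖) * ‖a - b‖ := by
    refine (norm_add_le _ _).trans ?_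
    linarith [Matrix.frobenius_norm_mul a (a - b), Matrix.frobenius_norm_mul (a - b) b]
  have k3 : 2 * ‖a - b‖ ≤ (‖X‖ + ‖Y‖) * ‖X - Y‖ + (‖a‖ + ‖b‖) * ‖a - b‖ := by
    have e : ‖(2 : ℝ) • (a - b)‖ = 2 * ‖a - b‖ := by rw [norm_smul]; norm_num
    rw [← e, key]
    exact (norm_add_le _ _).trans (add_le_add k1 k2)
  have k4 : ‖a - b‖ ≤ (‖X‖ + ‖Y‖) * ‖X - Y‖ := by nlinarith [norm_nonneg (a - b)]
  obtain ⟨rA, -⟩ := norm_inv_metricRoot_le hm hA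
  obtain ⟨rB, -⟩ := norm_inv_metricRoot_le hm hB
  have hA1 : (metricRoot A)⁻¹ * metricRoot A = 1 := mul_eq_one_comm.1 (metricRoot_mul_inv hm hA)
  have k5 : (metricRoot A)⁻¹ - (metricRoot B)⁻¹ = (metricRoot A)⁻¹ * ((a - b) * (metricRoot B)⁻¹) := by
    have : a - b = metricRoot B - metricRoot A := by rw [ha, hb]; abel
    rw [this, sub_mul, metricRoot_mul_inv hm hB, mul_sub, mul_one, ← mul_assoc, hA1, one_mul]
  calc ‖(metricRoot A)⁻¹ - (metricRoot B)⁻¹‖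
      ≤ ‖(metricRoot A)⁻¹‖ * (‖a - b‖ * ‖(metricRoot B)⁻¹‖) := by
        rw [k5]
        refine (Matrix.frobenius_norm_mul _ _).trans ?_
        gcongr
        exact Matrix.frobenius_norm_mul _ _
    _ ≤ (11 / 10 * m) * (((‖X‖ + ‖Y‖) * ‖X - Y‖) * (11 / 10 * m)) := by gcongr
    _ = (121 / 100 * (m * ‖X‖ + m * ‖Y‖)) * (m * ‖X - Y‖) := by ring
    _ ≤ (121 / 100 * (1 / 16 + 1 / 16)) * (m * ‖X - Y‖) := by gcongr
    _ ≤ m * ‖X - Y‖ := by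
        have : 0 ≤ m * ‖X - Y‖ := by positivity
        linarith

/-- A frame of `ℝ^m` representing the inverse of the metric induced on a graph. -/
noncomputable def metricFrame (A : EuclideanSpace ℝ (Fin m) →L[ℝ] EuclideanSpace ℝ (Fin n))
    (k : Fin m) : EuclideanSpace ℝ (Fin m) :=
  WithLp.toLp 2 fun i => (metricRoot A)⁻¹ i k

theorem inv_metricRoot_transpose (A : EuclideanSpace ℝ (Fin m) →L[ℝ] EuclideanSpace ℝ (Fin n)) :
    ((metricRoot A)⁻¹)ᵀ = (metricRoot A)⁻¹ := by
  rw [Matrix.transpose_nonsing_inv, metricRoot_transpose]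

theorem inv_inducedMetric_apply (hm : 1 ≤ m)
    {A : EuclideanSpace ℝ (Fin m) →L[ℝ] EuclideanSpace ℝ (Fin n)}
    (hA : ‖A‖ ≤ gradientThreshold m) (i j : Fin m) :
    (inducedMetric A)⁻¹ i j = ∑ k, metricFrame A k i * metricFrame A k j := by
  rw [← inv_metricRoot_mul_self hm hA, Matrix.mul_apply]
  refine Finset.sum_congr rfl fun k _ => ?_
  have := congrFun (congrFun (inv_metricRoot_transpose A) k) j
  rw [← this]; rfl

/-- This turns `g^{ij} ∂ᵢ∂ⱼ` into a sum of pure second derivatives along lines, to which the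
one-variable second derivative test applies. -/
theorem sum_inv_inducedMetric_smul (hm : 1 ≤ m)
    {A : EuclideanSpace ℝ (Fin m) →L[ℝ] EuclideanSpace ℝ (Fin n)}
    (hA : ‖A‖ ≤ gradientThreshold m)
    (B : EuclideanSpace ℝ (Fin m) →L[ℝ] EuclideanSpace ℝ (Fin m) →L[ℝ] EuclideanSpace ℝ (Fin n)) :
    ∑ i, ∑ j, (inducedMetric A)⁻¹ i j •
      B (EuclideanSpace.single i (1 : ℝ)) (EuclideanSpace.single j (1 : ℝ))
    = ∑ k, B (metricFrame A k) (metricFrame A k) := by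
  have hv (v : EuclideanSpace ℝ (Fin m)) : v = ∑ j, v j • EuclideanSpace.single j (1 : ℝ) := by
    ext i; simp [Pi.single_apply]
  have hB (v : EuclideanSpace ℝ (Fin m)) : B v v = ∑ i, ∑ j, (v i * v j) •
      B (EuclideanSpace.single i (1 : ℝ)) (EuclideanSpace.single j (1 : ℝ)) := by
    conv_lhs => rw [hv v]
    simp only [map_sum, map_smul, sum_apply, smul_apply,
      Finset.smul_sum, smul_smul]
    rw [Finset.sum_comm]
    simp only [mul_comm]
  simp only [inv_inducedMetric_apply hm hA, hB, Finset.sum_smul]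
  rw [Finset.sum_comm_cycle]

theorem sum_norm_metricFrame_sq_le (hm : 1 ≤ m)
    {A : EuclideanSpace ℝ (Fin m) →L[ℝ] EuclideanSpace ℝ (Fin n)}
    (hA : ‖A‖ ≤ gradientThreshold m) : ∑ k, ‖metricFrame A k‖ ^ 2 ≤ 4 * (m : ℝ) ^ 2 := by
  have h : ∑ k, ‖metricFrame A k‖ ^ 2 = ‖(metricRoot A)⁻¹‖ ^ 2 := by
    rw [frobenius_norm_sq_eq_sum, Finset.sum_comm]
    simp [EuclideanSpace.norm_sq_eq, metricFrame]
  rw [h]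
  calc ‖(metricRoot A)⁻¹‖ ^ 2 ≤ (11 / 10 * m) ^ 2 := by gcongr; exact (norm_inv_metricRoot_le hm hA).1
    _ ≤ 4 * (m : ℝ) ^ 2 := by nlinarith [sq_nonneg (m : ℝ)]

/-- Ellipticity from below: `(metricRoot A)⁻¹` is within `1/2` of the identity, so it shrinks a
vector by at most one half. -/
theorem le_sum_inner_metricFrame_sq (hm : 1 ≤ m)
    {A : EuclideanSpace ℝ (Fin m) →L[ℝ] EuclideanSpace ℝ (Fin n)}
    (hA : ‖A‖ ≤ gradientThreshold m) (v : EuclideanSpace ℝ (Fin m)) :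
    ‖v‖ ^ 2 / 4 ≤ ∑ k, inner ℝ v (metricFrame A k) ^ 2 := by
  set V : Matrix (Fin 1) (Fin m) ℝ := Matrix.of fun _ j => v j
  have hV : ‖V‖ = ‖v‖ := by
    refine (sq_eq_sq₀ (by positivity) (by positivity)).1 ?_
    rw [frobenius_norm_sq_eq_sum, EuclideanSpace.norm_sq_eq]
    simp [V]
  have h1 : ∑ k, inner ℝ v (metricFrame A k) ^ 2 = ‖V * (metricRoot A)⁻¹‖ ^ 2 := by
    rw [frobenius_norm_sq_eq_sum]
    simp [V, Matrix.mul_apply, metricFrame, PiLp.inner_apply, mul_comm]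
  have h2 : ‖v‖ ≤ ‖V * (metricRoot A)⁻¹‖ + ‖v‖ * (1 / 2) := by
    have e : V = V * (metricRoot A)⁻¹ - V * ((metricRoot A)⁻¹ - 1) := by
      rw [Matrix.mul_sub, Matrix.mul_one]; abel
    rw [← hV]
    calc ‖V‖ = ‖V * (metricRoot A)⁻¹ - V * ((metricRoot A)⁻¹ - 1)‖ := by rw [← e]
      _ ≤ ‖V * (metricRoot A)⁻¹‖ + ‖V * ((metricRoot A)⁻¹ - 1)‖ := norm_sub_le _ _
      _ ≤ ‖V * (metricRoot A)⁻¹‖ + ‖V‖ * (1 / 2) := by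
        gcongr
        refine (Matrix.frobenius_norm_mul _ _).trans ?_
        gcongr
        exact (norm_inv_metricRoot_le hm hA).2
  rw [h1]
  nlinarith [norm_nonneg v]

/-- The frames of two small gradients are coupled: their distance is controlled by the distance of
their images. -/
theorem sum_norm_metricFrame_sub_sq_le (hm : 1 ≤ m)
    {A B : EuclideanSpace ℝ (Fin m) →L[ℝ] EuclideanSpace ℝ (Fin n)}
    (hA : ‖A‖ ≤ gradientThreshold m) (hB : ‖B‖ ≤ gradientThreshold m) {L : ℝ} (hL0 : 0 ≤ L)
    (hL : L ≤ gradientThreshold m) :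
    ∑ k, L ^ 2 * ‖metricFrame A k - metricFrame B k‖ ^ 2
      ≤ ∑ k, ‖A (metricFrame A k) - B (metricFrame B k)‖ ^ 2 := by
  have h3 : (1 : ℝ) ≤ m := by exact_mod_cast hm
  set R := (metricRoot A)⁻¹ with hR
  set S := (metricRoot B)⁻¹ with hS
  set X := jacobianMatrix A with hX
  set Y := jacobianMatrix B with hY
  have h1 : ∑ k, L ^ 2 * ‖metricFrame A k - metricFrame B k‖ ^ 2 = (L * ‖R - S‖) ^ 2 := by
    rw [mul_pow, frobenius_norm_sq_eq_sum, Finset.sum_comm, ← Finset.mul_sum]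
    simp [EuclideanSpace.norm_sq_eq, metricFrame, hR, hS]
  have h2 : ∑ k, ‖A (metricFrame A k) - B (metricFrame B k)‖ ^ 2 = ‖X * R - Y * S‖ ^ 2 := by
    rw [frobenius_norm_sq_eq_sum, Finset.sum_comm]
    simp [EuclideanSpace.norm_sq_eq, map_eq_jacobianMatrix_mulVec, Matrix.mul_apply, metricFrame,
      hR, hS, hX, hY]
  rw [h1, h2]
  have hD := norm_inv_metricRoot_sub_le hm hA hB
  -- The last two terms are at most `(1/2 + 1/16)‖X - Y‖`, so `‖X * R - Y * S‖` controls a fixed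
  -- fraction of `‖X - Y‖`, which in turn controls `L‖R - S‖`.
  have e : X - Y = (X * R - Y * S) - (X - Y) * (R - 1) - Y * (R - S) := by
    simp only [Matrix.mul_sub, Matrix.sub_mul, Matrix.mul_one]; abel
  have h4 : ‖X - Y‖ ≤ ‖X * R - Y * S‖ + ‖X - Y‖ * (1 / 2) + ‖Y‖ * ‖R - S‖ := by
    calc ‖X - Y‖ = ‖(X * R - Y * S) - (X - Y) * (R - 1) - Y * (R - S)‖ := by rw [← e]
      _ ≤ ‖X * R - Y * S‖ + ‖(X - Y) * (R - 1)‖ + ‖Y * (R - S)‖ :=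
        (norm_sub_le _ _).trans (by gcongr; exact norm_sub_le _ _)
      _ ≤ _ := by
        gcongr
        · refine (Matrix.frobenius_norm_mul _ _).trans ?_
          gcongr
          exact (norm_inv_metricRoot_le hm hA).2
        · exact Matrix.frobenius_norm_mul _ _
  have h5 : m * L ≤ 1 / 16 := by
    calc m * L ≤ m * (m * gradientThreshold m) := by
          gcongr
          have := gradientThreshold_pos hm
          nlinarith
      _ = 1 / 16 := by unfold gradientThreshold; field_simp
  have hYn := norm_jacobianMatrix_le_of_threshold hm hB
  have h6 : ‖Y‖ * ‖R - S‖ ≤ 1 / 16 * ‖X - Y‖ := by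
    calc ‖Y‖ * ‖R - S‖ ≤ ‖Y‖ * (m * ‖X - Y‖) := by gcongr
      _ = (m * ‖Y‖) * ‖X - Y‖ := by ring
      _ ≤ _ := by gcongr
  have h7 : L * ‖R - S‖ ≤ 1 / 16 * ‖X - Y‖ := by
    calc L * ‖R - S‖ ≤ L * (m * ‖X - Y‖) := by gcongr
      _ = (m * L) * ‖X - Y‖ := by ring
      _ ≤ _ := by gcongr
  gcongr
  linarith [norm_nonneg (X - Y)]

end LinearAlgebra

/-! ### Derivative tests and derivatives along lines. -/

section Calculus

/-- If `c > 0`, the point is also a local minimum, so `h` is locally constant and `c = 0`. -/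
theorem IsLocalMax.second_deriv_nonpos {h h' : ℝ → ℝ} {c x : ℝ} (hmax : IsLocalMax h x)
    (h1 : ∀ᶠ s in 𝓝 x, HasDerivAt h (h' s) s) (h2 : HasDerivAt h' c x) : c ≤ 0 := by
  by_contra! hc
  have e1 : deriv h =ᶠ[𝓝 x] h' := h1.mono fun s hs => hs.deriv
  have e2 : deriv (deriv h) x = c := by rw [e1.deriv_eq]; exact h2.deriv
  have hmin : IsLocalMin h x := isLocalMin_of_deriv_deriv_pos (by rw [e2]; exact hc)
    hmax.deriv_eq_zero h1.self_of_nhds.continuousAt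
  have e3 : h =ᶠ[𝓝 x] fun _ => h x := by
    filter_upwards [hmax, hmin] with s hs1 hs2 using le_antisymm hs1 hs2
  have e4 : deriv h =ᶠ[𝓝 x] fun _ => 0 := by
    filter_upwards [e3.eventuallyEq_nhds] with s hs
    rw [hs.deriv_eq]; simp
  rw [e4.deriv_eq] at e2
  simp at e2
  exact hc.ne e2

/-- Only the past is compared, so the test also applies to a maximum at the final time of a slab. -/
theorem HasDerivAt.nonneg_of_le_left {f : ℝ → ℝ} {c a t : ℝ} (h : HasDerivAt f c t) (hat : a < t)
    (hmax : ∀ s ∈ Icc a t, f s ≤ f t) : 0 ≤ c := by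
  have h1 := (hasDerivWithinAt_iff_tendsto_slope' (s := Iio t) (by simp)).1 (h.hasDerivWithinAt)
  refine ge_of_tendsto h1 ?_
  filter_upwards [Ioo_mem_nhdsLT hat] with s hs
  rw [slope_def_field]
  exact div_nonneg_of_nonpos (by linarith [hmax s ⟨hs.1.le, hs.2.le⟩]) (by linarith [hs.2])

variable {m n : ℕ} {Ω : Set (EuclideanSpace ℝ (Fin m))} {T t : ℝ}
  {u : EuclideanSpace ℝ (Fin m) → ℝ → EuclideanSpace ℝ (Fin n)} {x : EuclideanSpace ℝ (Fin m)}

theorem spaceDeriv_eq_fderiv (hΩ : IsOpen Ω) (hx : x ∈ Ω) :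
    spaceDeriv Ω u x t = fderiv ℝ (fun y => u y t) x :=
  fderivWithin_of_mem_nhds (Filter.mem_of_superset (hΩ.mem_nhds hx) subset_closure)

theorem hasFDerivAt_spaceDeriv (hΩ : IsOpen Ω) (hu : ContDiffOn ℝ 2 (fun y => u y t) Ω)
    (hx : x ∈ Ω) : HasFDerivAt (fun y => u y t) (spaceDeriv Ω u x t) x := by
  rw [spaceDeriv_eq_fderiv hΩ hx]
  exact ((hu.contDiffAt (hΩ.mem_nhds hx)).differentiableAt (by norm_num)).hasFDerivAt

theorem hasFDerivAt_spaceDeriv2 (hΩ : IsOpen Ω) (hu : ContDiffOn ℝ 2 (fun y => u y t) Ω)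
    (hx : x ∈ Ω) : HasFDerivAt (fun y => spaceDeriv Ω u y t) (spaceDeriv2 Ω u x t) x := by
  have h1 : spaceDeriv2 Ω u x t = fderiv ℝ (fun y => spaceDeriv Ω u y t) x :=
    fderivWithin_of_mem_nhds (Filter.mem_of_superset (hΩ.mem_nhds hx) subset_closure)
  rw [h1]
  refine DifferentiableAt.hasFDerivAt ?_
  have h2 : (fun y => spaceDeriv Ω u y t) =ᶠ[𝓝 x] fderiv ℝ (fun y => u y t) := by
    filter_upwards [hΩ.mem_nhds hx] with y hy using spaceDeriv_eq_fderiv hΩ hy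
  rw [h2.differentiableAt_iff]
  exact ((hu.contDiffAt (hΩ.mem_nhds hx)).fderiv_right (m := 1) (by norm_num)).differentiableAt
    (by norm_num)

theorem eventually_add_smul_mem (hΩ : IsOpen Ω) (hx : x ∈ Ω) (ξ : EuclideanSpace ℝ (Fin m)) :
    ∀ᶠ s : ℝ in 𝓝 0, x + s • ξ ∈ Ω := by
  have hc : ContinuousAt (fun s : ℝ => x + s • ξ) 0 := by fun_prop
  exact hc (by simpa using hΩ.mem_nhds hx)

theorem hasDerivAt_add_smul (x ξ : EuclideanSpace ℝ (Fin m)) (s : ℝ) :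
    HasDerivAt (fun s : ℝ => x + s • ξ) ξ s := by
  simpa using ((hasDerivAt_id s).smul_const ξ).const_add x

theorem eventually_hasDerivAt_line (hΩ : IsOpen Ω) (hu : ContDiffOn ℝ 2 (fun y => u y t) Ω)
    (hx : x ∈ Ω) (ξ : EuclideanSpace ℝ (Fin m)) :
    ∀ᶠ s : ℝ in 𝓝 0, HasDerivAt (fun s : ℝ => u (x + s • ξ) t)
      (spaceDeriv Ω u (x + s • ξ) t ξ) s := by
  filter_upwards [eventually_add_smul_mem hΩ hx ξ] with s hs
  exact (hasFDerivAt_spaceDeriv hΩ hu hs).comp_hasDerivAt s (hasDerivAt_add_smul x ξ s)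

theorem hasDerivAt_spaceDeriv_line (hΩ : IsOpen Ω) (hu : ContDiffOn ℝ 2 (fun y => u y t) Ω)
    (hx : x ∈ Ω) (ξ : EuclideanSpace ℝ (Fin m)) :
    HasDerivAt (fun s : ℝ => spaceDeriv Ω u (x + s • ξ) t ξ) (spaceDeriv2 Ω u x t ξ ξ) 0 := by
  have h0 : x + (0 : ℝ) • ξ = x := by simp
  have h1 : HasFDerivAt (fun y => spaceDeriv Ω u y t) (spaceDeriv2 Ω u x t) (x + (0 : ℝ) • ξ) := by
    rw [h0]; exact hasFDerivAt_spaceDeriv2 hΩ hu hx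
  have h2 := h1.comp_hasDerivAt 0 (hasDerivAt_add_smul x ξ 0)
  exact h2.clm_apply (hasDerivAt_const 0 ξ) |>.congr_deriv (by simp)

theorem hasDerivAt_timeDeriv (ht : t ∈ Ioo 0 T)
    (hu : DifferentiableWithinAt ℝ (fun s => u x s) (Icc 0 T) t) :
    HasDerivAt (fun s => u x s) (timeDeriv T u x t) t :=
  hu.hasDerivWithinAt.hasDerivAt (Icc_mem_nhds ht.1 ht.2)

theorem IsSpacelikeGraphicMCF.contDiffOn_space (hu : IsSpacelikeGraphicMCF Ω T u)
    (ht : t ∈ Ioo 0 T) : ContDiffOn ℝ 2 (fun y => u y t) Ω := by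
  have h1 : ContDiffOn ℝ ∞ (fun y => u y t) Ω :=
    hu.smooth.comp (f := fun y => (y, t)) (by fun_prop) fun y hy => ⟨hy, ht⟩
  exact contDiffOn_infty.1 h1 2

theorem IsSpacelikeGraphicMCF.hasDerivAt_time (hu : IsSpacelikeGraphicMCF Ω T u) (hx : x ∈ Ω)
    (ht : t ∈ Ioo 0 T) : HasDerivAt (fun s => u x s) (timeDeriv T u x t) t := by
  have h1 : ContDiffOn ℝ ∞ (fun s => u x s) (Ioo 0 T) :=
    hu.smooth.comp (f := fun s => (x, s)) (by fun_prop) fun s hs => ⟨hx, hs⟩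
  exact hasDerivAt_timeDeriv ht ((h1.contDiffAt (Ioo_mem_nhds ht.1 ht.2)).differentiableAt
    (by simp)).differentiableWithinAt

theorem IsSpacelikeGraphicMCF.timeDeriv_eq_sum (hm : 1 ≤ m) (hu : IsSpacelikeGraphicMCF Ω T u)
    (hx : x ∈ Ω) (ht : t ∈ Ioo 0 T) (hD : ‖spaceDeriv Ω u x t‖ ≤ gradientThreshold m) :
    timeDeriv T u x t = ∑ k, spaceDeriv2 Ω u x t (metricFrame (spaceDeriv Ω u x t) k)
      (metricFrame (spaceDeriv Ω u x t) k) := by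
  rw [hu.flow x hx t ht, sum_inv_inducedMetric_smul hm hD]

end Calculus

/-! ### Two-point maximum principle. -/

section Lipschitz

variable {m n : ℕ} {Ω : Set (EuclideanSpace ℝ (Fin m))} {T τ L : ℝ}
  {u : EuclideanSpace ℝ (Fin m) → ℝ → EuclideanSpace ℝ (Fin n)}

/-- At an interior spatial maximum of `‖u x - u y‖² - L² ‖x - y‖²`, that function does not
increase in time along the flow. -/
theorem inner_timeDeriv_sub_nonpos (hm : 1 ≤ m) (hΩ : IsOpen Ω) (hu : IsSpacelikeGraphicMCF Ω T u)
    {t : ℝ} (ht : t ∈ Ioo 0 T) {x y : EuclideanSpace ℝ (Fin m)} (hx : x ∈ Ω) (hy : y ∈ Ω)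
    (hDx : ‖spaceDeriv Ω u x t‖ ≤ gradientThreshold m)
    (hDy : ‖spaceDeriv Ω u y t‖ ≤ gradientThreshold m)
    (hL0 : 0 ≤ L) (hL : L ≤ gradientThreshold m)
    (hmax : ∀ x' ∈ Ω, ∀ y' ∈ Ω, ‖u x' t - u y' t‖ ^ 2 - L ^ 2 * ‖x' - y'‖ ^ 2
      ≤ ‖u x t - u y t‖ ^ 2 - L ^ 2 * ‖x - y‖ ^ 2) :
    inner ℝ (u x t - u y t) (timeDeriv T u x t - timeDeriv T u y t) ≤ 0 := by
  have hC := hu.contDiffOn_space ht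
  set A := spaceDeriv Ω u x t with hA
  set B := spaceDeriv Ω u y t with hB
  set P := u x t - u y t with hP
  -- Second derivative test along `s ↦ (x + sξ, y + sη)`, each point using the frame of its own
  -- metric. The first-order terms contribute the two squares.
  have key (k : Fin m) :
      inner ℝ P (spaceDeriv2 Ω u x t (metricFrame A k) (metricFrame A k)
        - spaceDeriv2 Ω u y t (metricFrame B k) (metricFrame B k))
      + ‖A (metricFrame A k) - B (metricFrame B k)‖ ^ 2
      - L ^ 2 * ‖metricFrame A k - metricFrame B k‖ ^ 2 ≤ 0 := by
    set ξ := metricFrame A k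
    set η := metricFrame B k
    set p : ℝ → EuclideanSpace ℝ (Fin n) := fun s => u (x + s • ξ) t - u (y + s • η) t with hp
    set p' : ℝ → EuclideanSpace ℝ (Fin n) := fun s =>
      spaceDeriv Ω u (x + s • ξ) t ξ - spaceDeriv Ω u (y + s • η) t η with hp'
    set q : ℝ → EuclideanSpace ℝ (Fin m) := fun s => (x + s • ξ) - (y + s • η) with hq
    have dp : ∀ᶠ s in 𝓝 0, HasDerivAt p (p' s) s := by
      filter_upwards [eventually_hasDerivAt_line hΩ hC hx ξ, eventually_hasDerivAt_line hΩ hC hy η]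
        with s h1 h2 using h1.sub h2
    have dp' : HasDerivAt p' (spaceDeriv2 Ω u x t ξ ξ - spaceDeriv2 Ω u y t η η) 0 :=
      (hasDerivAt_spaceDeriv_line hΩ hC hx ξ).sub (hasDerivAt_spaceDeriv_line hΩ hC hy η)
    have dq (s : ℝ) : HasDerivAt q (ξ - η) s :=
      (hasDerivAt_add_smul x ξ s).sub (hasDerivAt_add_smul y η s)
    have hloc : IsLocalMax (fun s => ‖p s‖ ^ 2 - L ^ 2 * ‖q s‖ ^ 2) 0 := by
      filter_upwards [eventually_add_smul_mem hΩ hx ξ, eventually_add_smul_mem hΩ hy η]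
        with s h1 h2
      simpa [hp, hq] using hmax _ h1 _ h2
    have d1 : ∀ᶠ s in 𝓝 0, HasDerivAt (fun s => ‖p s‖ ^ 2 - L ^ 2 * ‖q s‖ ^ 2)
        (2 * inner ℝ (p s) (p' s) - L ^ 2 * (2 * inner ℝ (q s) (ξ - η))) s := by
      filter_upwards [dp] with s hs
      exact hs.norm_sq.sub ((dq s).norm_sq.const_mul _)
    have d2 := ((dp.self_of_nhds.inner ℝ dp').const_mul 2).sub
      ((((dq 0).inner ℝ (hasDerivAt_const 0 (ξ - η))).const_mul 2).const_mul (L ^ 2))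
    have h := hloc.second_deriv_nonpos d1 d2
    have ep : p 0 = P := by simp [hp, hP]
    have ep' : p' 0 = A ξ - B η := by simp [hp', hA, hB]
    rw [ep, ep', inner_zero_right, zero_add, real_inner_self_eq_norm_sq,
      real_inner_self_eq_norm_sq] at h
    linarith
  have hsum := Finset.sum_nonpos fun k (_ : k ∈ Finset.univ) => key k
  -- Summed over `k`, the two squares have a nonnegative difference, and the second derivatives add
  -- up to the flow.
  have hcoup := sum_norm_metricFrame_sub_sq_le hm hDx hDy hL0 hL
  rw [hu.timeDeriv_eq_sum hm hx ht hDx, hu.timeDeriv_eq_sum hm hy ht hDy,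
    ← Finset.sum_sub_distrib, inner_sum]
  rw [Finset.sum_sub_distrib, Finset.sum_add_distrib] at hsum
  linarith

/-- A Lipschitz bound at the parabolic boundary propagates to the interior, as long as the gradient
is small. -/
theorem norm_sub_le_of_parabolic_boundary (hm : 1 ≤ m) (hΩ : IsBoundedConvexC2Domain Ω)
    (hu : IsSpacelikeGraphicMCF Ω T u) (hτ : τ ∈ Ioo 0 T)
    (hD : ∀ x ∈ Ω, ∀ t ∈ Icc 0 τ, ‖spaceDeriv Ω u x t‖ ≤ gradientThreshold m)
    (hL0 : 0 ≤ L) (hL : L ≤ gradientThreshold m)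
    (hb : ∀ x ∈ frontier Ω, ∀ y ∈ closure Ω, ∀ t ∈ Icc 0 τ, ‖u y t - u x t‖ ≤ L * ‖y - x‖)
    (h0 : ∀ x ∈ closure Ω, ∀ y ∈ closure Ω, ‖u x 0 - u y 0‖ ≤ L * ‖x - y‖) :
    ∀ x ∈ closure Ω, ∀ y ∈ closure Ω, ∀ t ∈ Icc 0 τ, ‖u x t - u y t‖ ≤ L * ‖x - y‖ := by
  intro a ha b hb' r hr
  by_contra! hcon
  set Z : EuclideanSpace ℝ (Fin m) → EuclideanSpace ℝ (Fin m) → ℝ → ℝ := fun x y t =>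
    ‖u x t - u y t‖ ^ 2 - L ^ 2 * ‖x - y‖ ^ 2 with hZ
  have Znonpos {x y t} (h : ‖u x t - u y t‖ ≤ L * ‖x - y‖) : Z x y t ≤ 0 := by
    have : ‖u x t - u y t‖ ^ 2 ≤ (L * ‖x - y‖) ^ 2 := by gcongr
    rw [mul_pow] at this
    simp only [hZ]; linarith
  have hZ0 : 0 < Z a b r := by
    have : (L * ‖a - b‖) ^ 2 < ‖u a r - u b r‖ ^ 2 := by gcongr
    rw [mul_pow] at this
    simp only [hZ]; linarith
  have hτ0 := hτ.1
  -- The tilt `-σ t` costs at most half of `Z a b r`, so the maximum stays positive. It forces the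
  -- time derivative of `Z` there to be at least `σ > 0`, against `inner_timeDeriv_sub_nonpos`.
  set σ := Z a b r / (2 * τ) with hσ
  have hσ0 : 0 < σ := by positivity
  have hcomp : IsCompact (closure Ω) := hΩ.isBounded.isCompact_closure
  have hK : IsCompact ((closure Ω ×ˢ closure Ω) ×ˢ Icc (0 : ℝ) τ) :=
    (hcomp.prod hcomp).prod isCompact_Icc
  have hcu := hu.c1_closure.continuousOn
  have hcont : ContinuousOn (fun z : (EuclideanSpace ℝ (Fin m) × EuclideanSpace ℝ (Fin m)) × ℝ =>
      Z z.1.1 z.1.2 z.2 - σ * z.2) ((closure Ω ×ˢ closure Ω) ×ˢ Icc (0 : ℝ) τ) := by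
    have c1 : ContinuousOn (fun z : (EuclideanSpace ℝ (Fin m) × EuclideanSpace ℝ (Fin m)) × ℝ =>
        u z.1.1 z.2) ((closure Ω ×ˢ closure Ω) ×ˢ Icc (0 : ℝ) τ) :=
      hcu.comp (f := fun z : (EuclideanSpace ℝ (Fin m) × EuclideanSpace ℝ (Fin m)) × ℝ =>
        (z.1.1, z.2)) (by fun_prop)
        fun z hz => ⟨hz.1.1, hz.2.1, hz.2.2.trans hτ.2.le⟩
    have c2 : ContinuousOn (fun z : (EuclideanSpace ℝ (Fin m) × EuclideanSpace ℝ (Fin m)) × ℝ =>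
        u z.1.2 z.2) ((closure Ω ×ˢ closure Ω) ×ˢ Icc (0 : ℝ) τ) :=
      hcu.comp (f := fun z : (EuclideanSpace ℝ (Fin m) × EuclideanSpace ℝ (Fin m)) × ℝ =>
        (z.1.2, z.2)) (by fun_prop)
        fun z hz => ⟨hz.1.2, hz.2.1, hz.2.2.trans hτ.2.le⟩
    exact (((c1.sub c2).norm.pow 2).sub (by fun_prop)).sub (by fun_prop)
  obtain ⟨⟨⟨x, y⟩, t⟩, ⟨⟨hx, hy⟩, ht⟩, hmax⟩ := hK.exists_isMaxOn ⟨((a, b), r), ⟨ha, hb'⟩, hr⟩ hcont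
  simp only [isMaxOn_iff, mem_prod, Prod.forall, and_imp] at hmax hx hy ht
  have hpos : 0 < Z x y t - σ * t := by
    have h1 := hmax a b r ha hb' hr
    have h2 : σ * r ≤ Z a b r / 2 := by
      calc σ * r ≤ σ * τ := by gcongr; exact hr.2
        _ = Z a b r / 2 := by rw [hσ]; field_simp
    linarith
  have hZpos : 0 < Z x y t := by nlinarith [ht.1]
  have ht0 : 0 < t := by
    rcases ht.1.eq_or_lt with h | h
    · subst h; exact absurd (Znonpos (h0 x hx y hy)) hZpos.not_ge
    · exact h
  have hxΩ : x ∈ Ω := by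
    by_contra h
    have hxf : x ∈ frontier Ω := ⟨hx, by rwa [hΩ.isOpen.interior_eq]⟩
    have := hb x hxf y hy t ht
    rw [norm_sub_rev, norm_sub_rev y] at this
    exact absurd (Znonpos this) hZpos.not_ge
  have hyΩ : y ∈ Ω := by
    by_contra h
    have hyf : y ∈ frontier Ω := ⟨hy, by rwa [hΩ.isOpen.interior_eq]⟩
    exact absurd (Znonpos (hb y hyf x hx t ht)) hZpos.not_ge
  have htT : t ∈ Ioo 0 T := ⟨ht0, ht.2.trans_lt hτ.2⟩
  have hfin := inner_timeDeriv_sub_nonpos (L := L) hm hΩ.isOpen hu htT hxΩ hyΩ (hD x hxΩ t ht)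
    (hD y hyΩ t ht) hL0 hL fun x' hx' y' hy' => by
      have := hmax x' y' t (subset_closure hx') (subset_closure hy') ht
      simpa [hZ] using this
  have hdt := (((hu.hasDerivAt_time hxΩ htT).sub (hu.hasDerivAt_time hyΩ htT)).norm_sq.sub_const
    (L ^ 2 * ‖x - y‖ ^ 2)).sub ((hasDerivAt_id t).const_mul σ)
  have := hdt.nonneg_of_le_left ht0 fun s hs => by
    simpa [hZ] using hmax x y s hx hy ⟨hs.1, hs.2.trans ht.2⟩
  simp only [Pi.sub_apply] at this
  linarith

end Lipschitz

/-! ### Boundary barrier from a supporting hyperplane. -/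

section Barrier

variable {m n : ℕ} {Ω : Set (EuclideanSpace ℝ (Fin m))} {T τ ε d : ℝ}
  {u φ : EuclideanSpace ℝ (Fin m) → ℝ → EuclideanSpace ℝ (Fin n)}

/-- A convex open set has an inward unit normal at each boundary point. -/
theorem exists_inward_unit_normal (hΩ : IsOpen Ω) (hne : Ω.Nonempty) (hc : Convex ℝ Ω)
    {x₀ : EuclideanSpace ℝ (Fin m)} (hx₀ : x₀ ∉ Ω) :
    ∃ ν : EuclideanSpace ℝ (Fin m), ‖ν‖ = 1 ∧ ∀ y ∈ closure Ω, 0 ≤ inner ℝ ν (y - x₀) := by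
  obtain ⟨f, hf⟩ := geometric_hahn_banach_point_open hc hΩ hx₀
  set v := (InnerProductSpace.toDual ℝ (EuclideanSpace ℝ (Fin m))).symm f with hv
  have hfv (y : EuclideanSpace ℝ (Fin m)) : inner ℝ v y = f y := by
    rw [hv, InnerProductSpace.toDual_symm_apply]
  have hpos : ∀ y ∈ Ω, 0 < inner ℝ v (y - x₀) := fun y hy => by
    rw [hfv, map_sub]; linarith [hf y hy]
  have hv0 : v ≠ 0 := by
    obtain ⟨y, hy⟩ := hne
    intro h
    have := hpos y hy
    rw [h, inner_zero_left] at this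
    exact this.false
  have hvn : 0 < ‖v‖ := norm_pos_iff.2 hv0
  refine ⟨‖v‖⁻¹ • v, by rw [norm_smul, norm_inv, norm_norm, inv_mul_cancel₀ hvn.ne'], ?_⟩
  have hcl : IsClosed {y : EuclideanSpace ℝ (Fin m) | 0 ≤ inner ℝ (‖v‖⁻¹ • v) (y - x₀)} :=
    isClosed_le continuous_const (by fun_prop)
  refine fun y hy => closure_minimal (fun z hz => ?_) hcl hy
  simp only [mem_ofPred_eq, inner_smul_left]
  exact mul_nonneg (by simp) (hpos z hz).le

/-- At an interior maximum of `⟪w, u - φ⟫ - K ℓ (2 d - ℓ)`, with `ℓ` affine with unit gradient `ν`,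
that function decreases in time. -/
theorem inner_timeDeriv_sub_le (hm : 1 ≤ m) (hΩ : IsOpen Ω) (hu : IsSpacelikeGraphicMCF Ω T u)
    {t K : ℝ} (hK : 0 ≤ K) (ht : t ∈ Ioo 0 T) {x x₀ ν : EuclideanSpace ℝ (Fin m)} (hx : x ∈ Ω)
    (hφ : ContDiffOn ℝ 2 (fun y => φ y t) Ω)
    (hD : ‖spaceDeriv Ω u x t‖ ≤ gradientThreshold m) (hν : ‖ν‖ = 1) {w : EuclideanSpace ℝ (Fin n)}
    (hw : ‖w‖ ≤ 1) (hε : 0 ≤ ε)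
    (hφ2 : ∀ v, ‖spaceDeriv2 Ω φ x t v v‖ ≤ ε * ‖v‖ ^ 2)
    (hmax : ∀ y ∈ Ω, inner ℝ w (u y t - φ y t)
        - K * (inner ℝ ν (y - x₀) * (2 * d - inner ℝ ν (y - x₀)))
      ≤ inner ℝ w (u x t - φ x t) - K * (inner ℝ ν (x - x₀) * (2 * d - inner ℝ ν (x - x₀)))) :
    inner ℝ w (timeDeriv T u x t) ≤ 4 * m ^ 2 * ε - K / 2 := by
  have hC := hu.contDiffOn_space ht
  set A := spaceDeriv Ω u x t with hA
  -- Along `ξ` the function `ℓ (2d - ℓ)` has second derivative `-2c²`; this strict concavity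
  -- produces the negative term.
  have key (k : Fin m) :
      inner ℝ w (spaceDeriv2 Ω u x t (metricFrame A k) (metricFrame A k))
        ≤ ε * ‖metricFrame A k‖ ^ 2 - 2 * K * inner ℝ ν (metricFrame A k) ^ 2 := by
    set ξ := metricFrame A k
    set c := inner ℝ ν ξ
    set ℓ : ℝ → ℝ := fun s => inner ℝ ν (x + s • ξ - x₀) with hℓ
    have dℓ (s : ℝ) : HasDerivAt ℓ c s := by
      simpa using (hasDerivAt_const s ν).inner ℝ ((hasDerivAt_add_smul x ξ s).sub_const x₀)
    have dp : ∀ᶠ s : ℝ in 𝓝 0, HasDerivAt (fun s : ℝ => u (x + s • ξ) t - φ (x + s • ξ) t)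
        (spaceDeriv Ω u (x + s • ξ) t ξ - spaceDeriv Ω φ (x + s • ξ) t ξ) s := by
      filter_upwards [eventually_hasDerivAt_line hΩ hC hx ξ, eventually_hasDerivAt_line hΩ hφ hx ξ]
        with s h1 h2 using h1.sub h2
    have dp' := (hasDerivAt_spaceDeriv_line hΩ hC hx ξ).sub
      (hasDerivAt_spaceDeriv_line hΩ hφ hx ξ)
    have hloc : IsLocalMax (fun s : ℝ => inner ℝ w (u (x + s • ξ) t - φ (x + s • ξ) t)
        - K * (ℓ s * (2 * d - ℓ s))) 0 := by
      filter_upwards [eventually_add_smul_mem hΩ hx ξ] with s h1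
      simpa [hℓ] using hmax _ h1
    have d1 : ∀ᶠ s : ℝ in 𝓝 0, HasDerivAt (fun s : ℝ =>
        inner ℝ w (u (x + s • ξ) t - φ (x + s • ξ) t) - K * (ℓ s * (2 * d - ℓ s)))
        (inner ℝ w (spaceDeriv Ω u (x + s • ξ) t ξ - spaceDeriv Ω φ (x + s • ξ) t ξ)
          - K * (2 * c * (d - ℓ s))) s := by
      filter_upwards [dp] with s hs
      refine (((hasDerivAt_const s w).inner ℝ hs).sub
        (((dℓ s).mul ((dℓ s).const_sub (2 * d))).const_mul K)).congr_deriv ?_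
      simp only [inner_zero_left, add_zero]
      ring
    have d2 := ((hasDerivAt_const 0 w).inner ℝ dp').sub
      ((((dℓ 0).const_sub d).const_mul (2 * c)).const_mul K)
    have h := hloc.second_deriv_nonpos d1 d2
    simp only [inner_zero_left, add_zero] at h
    have h2 : inner ℝ w (spaceDeriv2 Ω φ x t ξ ξ) ≤ ε * ‖ξ‖ ^ 2 := by
      refine (real_inner_le_norm _ _).trans ?_
      calc ‖w‖ * ‖spaceDeriv2 Ω φ x t ξ ξ‖ ≤ 1 * (ε * ‖ξ‖ ^ 2) := by gcongr; exact hφ2 ξ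
        _ = _ := one_mul _
    rw [inner_sub_right] at h
    linarith
  have hsum := Finset.sum_le_sum fun k (_ : k ∈ Finset.univ) => key k
  rw [← inner_sum, ← hu.timeDeriv_eq_sum hm hx ht hD, Finset.sum_sub_distrib, ← Finset.mul_sum,
    ← Finset.mul_sum] at hsum
  have h1 := sum_norm_metricFrame_sq_le hm hD
  have h2 := le_sum_inner_metricFrame_sq hm hD ν
  rw [hν] at h2
  have h3 := mul_le_mul_of_nonneg_left h1 hε
  have h4 := mul_le_mul_of_nonneg_left h2 (by positivity : 0 ≤ 2 * K)
  linarith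

/-- Boundary estimate: the solution stays close to the boundary data, as long as its gradient is
small. -/
theorem norm_sub_le_of_barrier (hm : 1 ≤ m) (hΩ : IsBoundedConvexC2Domain Ω)
    (hd : Metric.diam Ω ≤ d)
    (hφ : IsParabolicC2 Ω T φ) (hu : IsSpacelikeGraphicMCF Ω T u)
    (hbdry : ∀ x ∈ frontier Ω, ∀ t ∈ Icc 0 T, u x t = φ x t)
    (hinit : ∀ x ∈ closure Ω, u x 0 = φ x 0) (hτ : τ ∈ Ioo 0 T)
    (hD : ∀ x ∈ Ω, ∀ t ∈ Icc 0 τ, ‖spaceDeriv Ω u x t‖ ≤ gradientThreshold m) (hε : 0 < ε)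
    (hφ2 : ∀ x ∈ closure Ω, ∀ t ∈ Icc 0 T, ∀ v, ‖spaceDeriv2 Ω φ x t v v‖ ≤ ε * ‖v‖ ^ 2)
    (hφt : ∀ x ∈ closure Ω, ∀ t ∈ Icc 0 T, ‖timeDeriv T φ x t‖ ≤ ε)
    {x₀ : EuclideanSpace ℝ (Fin m)} (hx₀ : x₀ ∈ frontier Ω) :
    ∀ y ∈ closure Ω, ∀ t ∈ Icc 0 τ,
      ‖u y t - φ y t‖ ≤ 2 * (4 * (1 + 2 * m ^ 2) * ε) * d * ‖y - x₀‖ := by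
  -- With this `K`, `4m²ε - K/2 = -2ε`, which outweighs `|∂φ/∂t| ≤ ε`.
  set K := 4 * (1 + 2 * (m : ℝ) ^ 2) * ε with hK
  have hK0 : 0 ≤ K := by positivity
  have hx₀Ω : x₀ ∉ Ω := by rw [hΩ.isOpen.frontier_eq] at hx₀; exact hx₀.2
  obtain ⟨ν, hν, hℓ0⟩ := exists_inward_unit_normal hΩ.isOpen hΩ.nonempty hΩ.convex hx₀Ω
  have hℓle (y : EuclideanSpace ℝ (Fin m)) : inner ℝ ν (y - x₀) ≤ ‖y - x₀‖ := by
    simpa [hν] using real_inner_le_norm ν (y - x₀)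
  have hle_d : ∀ y ∈ closure Ω, ‖y - x₀‖ ≤ d := fun y hy => by
    rw [← dist_eq_norm]
    refine (Metric.dist_le_diam_of_mem hΩ.isBounded.closure hy (frontier_subset_closure hx₀)).trans ?_
    rwa [Metric.diam_closure]
  have hcomp : IsCompact (closure Ω ×ˢ Icc (0 : ℝ) τ) :=
    hΩ.isBounded.isCompact_closure.prod isCompact_Icc
  have hsub : closure Ω ×ˢ Icc (0 : ℝ) τ ⊆ closedCylinder Ω T :=
    fun z hz => ⟨hz.1, hz.2.1, hz.2.2.trans hτ.2.le⟩
  have main (w : EuclideanSpace ℝ (Fin n)) (hw : ‖w‖ ≤ 1) : ∀ y ∈ closure Ω, ∀ t ∈ Icc 0 τ,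
      inner ℝ w (u y t - φ y t) - K * (inner ℝ ν (y - x₀) * (2 * d - inner ℝ ν (y - x₀))) ≤ 0 := by
    have hcont : ContinuousOn (fun z : EuclideanSpace ℝ (Fin m) × ℝ =>
        inner ℝ w (u z.1 z.2 - φ z.1 z.2)
          - K * (inner ℝ ν (z.1 - x₀) * (2 * d - inner ℝ ν (z.1 - x₀))))
        (closure Ω ×ˢ Icc (0 : ℝ) τ) :=
      (continuousOn_const.inner ((hu.c1_closure.continuousOn.mono hsub).sub
        (hφ.continuous.mono hsub))).sub (by fun_prop)
    intro a ha r hr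
    obtain ⟨⟨x, t⟩, ⟨hx, ht⟩, hmax⟩ := hcomp.exists_isMaxOn ⟨(a, r), ha, hr⟩ hcont
    simp only [isMaxOn_iff, mem_prod, Prod.forall, and_imp] at hmax hx ht
    refine (hmax a r ha hr).trans ?_
    by_contra! hpos
    -- Since `0 ≤ ℓ ≤ d`, the barrier is nonnegative, so a positive maximum cannot occur where `u =
    -- φ`.
    have hbar : 0 ≤ K * (inner ℝ ν (x - x₀) * (2 * d - inner ℝ ν (x - x₀))) := by
      have h1 := hℓ0 x hx
      have h2 := hℓle x
      have h3 := hle_d x hx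
      exact mul_nonneg hK0 (mul_nonneg h1 (by linarith))
    have hne : u x t ≠ φ x t := fun h => by
      rw [h, sub_self, inner_zero_right] at hpos; linarith
    have ht0 : 0 < t := by
      rcases ht.1.eq_or_lt with h | h
      · subst h; exact absurd (hinit x hx) hne
      · exact h
    have htT : t ∈ Ioo 0 T := ⟨ht0, ht.2.trans_lt hτ.2⟩
    have htI : t ∈ Icc 0 T := ⟨htT.1.le, htT.2.le⟩
    have hxΩ : x ∈ Ω := by
      by_contra h
      exact hne (hbdry x ⟨hx, by rwa [hΩ.isOpen.interior_eq]⟩ t htI)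
    have h1 := inner_timeDeriv_sub_le (d := d) (x₀ := x₀) hm hΩ.isOpen hu hK0 htT hxΩ
      ((hφ.contDiff_space t htI).mono subset_closure) (hD x hxΩ t ht) hν hw hε.le
      (hφ2 x hx t htI) fun y hy => hmax y t (subset_closure hy) ht
    have hdφ : HasDerivAt (fun s => φ x s) (timeDeriv T φ x t) t :=
      hasDerivAt_timeDeriv htT (hφ.differentiable_time x hx t htI)
    have hdt := ((hasDerivAt_const t w).inner ℝ ((hu.hasDerivAt_time hxΩ htT).sub hdφ)).sub_const
      (K * (inner ℝ ν (x - x₀) * (2 * d - inner ℝ ν (x - x₀))))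
    have h2 := hdt.nonneg_of_le_left ht0 fun s hs => hmax x s hx ⟨hs.1, hs.2.trans ht.2⟩
    rw [inner_zero_left, add_zero, inner_sub_right] at h2
    have h3 : -inner ℝ w (timeDeriv T φ x t) ≤ ε := by
      refine (neg_le_abs _).trans ((abs_real_inner_le_norm _ _).trans ?_)
      calc ‖w‖ * ‖timeDeriv T φ x t‖ ≤ 1 * ε := by gcongr; exact hφt x hx t htI
        _ = ε := one_mul _
    rw [hK] at h1
    linarith
  intro y hy t ht
  have hbd : K * (inner ℝ ν (y - x₀) * (2 * d - inner ℝ ν (y - x₀))) ≤ 2 * K * d * ‖y - x₀‖ := by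
    have h1 := hℓ0 y hy
    have h2 := hℓle y
    have h3 := hle_d y hy
    calc K * (inner ℝ ν (y - x₀) * (2 * d - inner ℝ ν (y - x₀)))
        ≤ K * (‖y - x₀‖ * (2 * d)) := by gcongr <;> linarith
      _ = _ := by ring
  refine le_trans ?_ hbd
  -- The scalar estimate in the direction `w = p / |p|` recovers the full norm.
  set p := u y t - φ y t with hp
  rcases eq_or_ne p 0 with h0 | h0
  · have := main 0 (by simp) y hy t ht
    rw [inner_zero_left] at this
    rw [h0, norm_zero]; linarith
  · have hn : 0 < ‖p‖ := norm_pos_iff.2 h0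
    have := main (‖p‖⁻¹ • p)
      (by rw [norm_smul, norm_inv, norm_norm, inv_mul_cancel₀ hn.ne']) y hy t ht
    rw [← hp, real_inner_smul_left, real_inner_self_eq_norm_sq, sq, inv_mul_cancel_left₀ hn.ne']
      at this
    linarith

end Barrier

/-! ### Pointwise bounds from the parabolic norm. -/

section Norms

variable {m n : ℕ} {Ω : Set (EuclideanSpace ℝ (Fin m))} {T ε : ℝ}
  {φ : EuclideanSpace ℝ (Fin m) → ℝ → EuclideanSpace ℝ (Fin n)}

theorem tripleNorm_le (A : EuclideanSpace ℝ (Fin m) →L[ℝ] EuclideanSpace ℝ (Fin n)) :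
    tripleNorm A ≤ ‖A‖ₑ := by
  refine iSup₂_le fun v hv => ?_
  have h := A.le_opNorm v
  rw [mem_sphere_zero_iff_norm.1 hv, mul_one] at h
  exact enorm_le_iff_norm_le.2 h

theorem norm_le_of_tripleNorm_le (hε : 0 ≤ ε)
    {A : EuclideanSpace ℝ (Fin m) →L[ℝ] EuclideanSpace ℝ (Fin n)}
    (h : tripleNorm A ≤ ENNReal.ofReal ε) : ‖A‖ ≤ ε := by
  refine A.opNorm_le_of_unit_norm hε fun v hv => ?_
  have h1 := (le_iSup₂ (f := fun v (_ : v ∈ Metric.sphere (0 : EuclideanSpace ℝ (Fin m)) 1) => ‖A v‖ₑ)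
    v (by simpa using hv)).trans h
  rwa [← ofReal_norm, ENNReal.ofReal_le_ofReal_iff hε] at h1

theorem norm_apply_self_le_of_tripleNorm2_le (hε : 0 ≤ ε)
    {B : EuclideanSpace ℝ (Fin m) →L[ℝ] EuclideanSpace ℝ (Fin m) →L[ℝ] EuclideanSpace ℝ (Fin n)}
    (h : tripleNorm2 B ≤ ENNReal.ofReal ε) (v : EuclideanSpace ℝ (Fin m)) :
    ‖B v v‖ ≤ ε * ‖v‖ ^ 2 := by
  rcases eq_or_ne v 0 with rfl | hv
  · simp
  have hn : 0 < ‖v‖ := norm_pos_iff.2 hv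
  have h1 := (le_iSup₂
    (f := fun v (_ : v ∈ Metric.sphere (0 : EuclideanSpace ℝ (Fin m)) 1) => ‖B v v‖ₑ)
    (‖v‖⁻¹ • v) (by simp [norm_smul, hn.ne'])).trans h
  rw [← ofReal_norm, ENNReal.ofReal_le_ofReal_iff hε] at h1
  simp only [map_smul, smul_apply, norm_smul, norm_inv, norm_norm] at h1
  calc ‖B v v‖ = (‖v‖⁻¹ * (‖v‖⁻¹ * ‖B v v‖)) * ‖v‖ ^ 2 := by field_simp
    _ ≤ ε * ‖v‖ ^ 2 := by gcongr

theorem bounds_of_parabolicC2Norm_lt (hε : 0 < ε)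
    (h : parabolicC2Norm Ω T φ < ENNReal.ofReal ε) {x : EuclideanSpace ℝ (Fin m)}
    (hx : x ∈ closure Ω) {t : ℝ} (ht : t ∈ Icc 0 T) :
    ‖spaceDeriv Ω φ x t‖ ≤ ε ∧ (∀ v, ‖spaceDeriv2 Ω φ x t v v‖ ≤ ε * ‖v‖ ^ 2)
      ∧ ‖timeDeriv T φ x t‖ ≤ ε := by
  have hp : (x, t) ∈ closedCylinder Ω T := ⟨hx, ht⟩
  have h' := h.le
  unfold parabolicC2Norm at h'
  refine ⟨norm_le_of_tripleNorm_le hε.le ?_, norm_apply_self_le_of_tripleNorm2_le hε.le ?_, ?_⟩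
  · refine le_trans ?_ ((le_add_left le_rfl).trans ((le_add_right le_rfl).trans
      ((le_add_right le_rfl).trans h')))
    exact le_iSup₂ (f := fun (p : EuclideanSpace ℝ (Fin m) × ℝ) (_ : p ∈ closedCylinder Ω T) =>
      tripleNorm (spaceDeriv Ω φ p.1 p.2)) (x, t) hp
  · refine le_trans ?_ ((le_add_left le_rfl).trans ((le_add_right le_rfl).trans h'))
    exact le_iSup₂ (f := fun (p : EuclideanSpace ℝ (Fin m) × ℝ) (_ : p ∈ closedCylinder Ω T) =>
      tripleNorm2 (spaceDeriv2 Ω φ p.1 p.2)) (x, t) hp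
  · rw [← ENNReal.ofReal_le_ofReal_iff hε.le, ofReal_norm]
    refine le_trans ?_ ((le_add_left le_rfl).trans h')
    exact le_iSup₂ (f := fun (p : EuclideanSpace ℝ (Fin m) × ℝ) (_ : p ∈ closedCylinder Ω T) =>
      ‖timeDeriv T φ p.1 p.2‖ₑ) (x, t) hp

end Norms

/-! ### Gradient bound by continuity in time. -/

section Gradient

variable {m n : ℕ} {Ω : Set (EuclideanSpace ℝ (Fin m))} {T τ ε d : ℝ}
  {u φ : EuclideanSpace ℝ (Fin m) → ℝ → EuclideanSpace ℝ (Fin n)}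

theorem IsBoundedConvexC2Domain.uniqueDiffOn_closure (hΩ : IsBoundedConvexC2Domain Ω) :
    UniqueDiffOn ℝ (closure Ω) :=
  uniqueDiffOn_convex hΩ.convex.closure
    (hΩ.nonempty.mono (interior_maximal subset_closure hΩ.isOpen))

/-- Up to the boundary, `Du` is the space-time derivative restricted to spatial directions. The
identification needs unique differentiability, supplied by convexity and nonempty interior. -/
theorem continuousOn_spaceDeriv (hT : 0 < T) (hΩ : IsBoundedConvexC2Domain Ω)
    (hu : ContDiffOn ℝ 1 (fun p : EuclideanSpace ℝ (Fin m) × ℝ => u p.1 p.2)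
      (closedCylinder Ω T)) :
    ContinuousOn (fun p : EuclideanSpace ℝ (Fin m) × ℝ => spaceDeriv Ω u p.1 p.2)
      (closedCylinder Ω T) := by
  have hS : UniqueDiffOn ℝ (closedCylinder Ω T) :=
    hΩ.uniqueDiffOn_closure.prod (uniqueDiffOn_Icc hT)
  have h1 := hu.continuousOn_fderivWithin hS le_rfl
  have h2 : ContinuousOn (fun p => (fderivWithin ℝ
      (fun p : EuclideanSpace ℝ (Fin m) × ℝ => u p.1 p.2) (closedCylinder Ω T) p).comp
      (ContinuousLinearMap.inl ℝ (EuclideanSpace ℝ (Fin m)) ℝ)) (closedCylinder Ω T) :=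
    h1.clm_comp continuousOn_const
  refine h2.congr fun p hp => ?_
  have h3 := ((hu.differentiableOn one_ne_zero) p hp).hasFDerivWithinAt
  have h4 : HasFDerivWithinAt (fun y => (y, p.2))
      (ContinuousLinearMap.inl ℝ (EuclideanSpace ℝ (Fin m)) ℝ) (closure Ω) p.1 :=
    (hasFDerivAt_prodMk_left p.1 p.2).hasFDerivWithinAt
  have h5 : MapsTo (fun y => (y, p.2)) (closure Ω) (closedCylinder Ω T) := fun y hy => ⟨hy, hp.2⟩
  exact (h3.comp p.1 h4 h5).fderivWithin (hΩ.uniqueDiffOn_closure p.1 hp.1)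

/-- A small gradient on `[0, τ]` is controlled by the norm of the boundary data. -/
theorem norm_spaceDeriv_le_of_small (hm : 1 ≤ m) (hΩ : IsBoundedConvexC2Domain Ω)
    (hd : Metric.diam Ω ≤ d) (hd0 : 0 ≤ d)
    (hφ : IsParabolicC2 Ω T φ) (hu : IsSpacelikeGraphicMCF Ω T u)
    (hbdry : ∀ x ∈ frontier Ω, ∀ t ∈ Icc 0 T, u x t = φ x t)
    (hinit : ∀ x ∈ closure Ω, u x 0 = φ x 0) (hε : 0 < ε)
    (hnorm : parabolicC2Norm Ω T φ < ENNReal.ofReal ε)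
    (hεd : (8 * (1 + 2 * m ^ 2) * d + 1) * ε ≤ gradientThreshold m) (hτ : τ ∈ Ioo 0 T)
    (hD : ∀ x ∈ Ω, ∀ t ∈ Icc 0 τ, ‖spaceDeriv Ω u x t‖ ≤ gradientThreshold m) :
    ∀ x ∈ Ω, ∀ t ∈ Icc 0 τ, ‖spaceDeriv Ω u x t‖ ≤ (8 * (1 + 2 * m ^ 2) * d + 1) * ε := by
  -- The first summand is the barrier slope `2Kd`; the extra `ε` is the Lipschitz constant of `φ`.
  set L := (8 * (1 + 2 * (m : ℝ) ^ 2) * d + 1) * ε with hL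
  have hL0 : 0 ≤ L := by positivity
  have hεL : ε ≤ L := by
    have : 0 ≤ 8 * (1 + 2 * (m : ℝ) ^ 2) * d * ε := by positivity
    rw [hL]; linarith
  have hT : 0 < T := hτ.1.trans hτ.2
  have hφL {t : ℝ} (ht : t ∈ Icc 0 T) {x y : EuclideanSpace ℝ (Fin m)} (hx : x ∈ closure Ω)
      (hy : y ∈ closure Ω) : ‖φ y t - φ x t‖ ≤ ε * ‖y - x‖ :=
    hΩ.convex.closure.norm_image_sub_le_of_norm_fderivWithin_le
      ((hφ.contDiff_space t ht).differentiableOn two_ne_zero)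
      (fun z hz => (bounds_of_parabolicC2Norm_lt hε hnorm hz ht).1) hx hy
  have hlip := norm_sub_le_of_parabolic_boundary hm hΩ hu hτ hD hL0 hεd
    (fun x hx y hy t ht => by
      have htT : t ∈ Icc 0 T := ⟨ht.1, ht.2.trans hτ.2.le⟩
      have h1 := norm_sub_le_of_barrier hm hΩ hd hφ hu hbdry hinit hτ hD hε
        (fun x hx t ht => (bounds_of_parabolicC2Norm_lt hε hnorm hx ht).2.1)
        (fun x hx t ht => (bounds_of_parabolicC2Norm_lt hε hnorm hx ht).2.2) hx y hy t ht
      have h2 := hφL htT (frontier_subset_closure hx) hy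
      rw [hbdry x hx t htT]
      calc ‖u y t - φ x t‖ = ‖(u y t - φ y t) + (φ y t - φ x t)‖ := by rw [sub_add_sub_cancel]
        _ ≤ _ := norm_add_le _ _
        _ ≤ 2 * (4 * (1 + 2 * m ^ 2) * ε) * d * ‖y - x‖ + ε * ‖y - x‖ := add_le_add h1 h2
        _ = L * ‖y - x‖ := by rw [hL]; ring)
    (fun x hx y hy => by
      rw [hinit x hx, hinit y hy]
      exact (hφL ⟨le_rfl, hT.le⟩ hy hx).trans (by gcongr))
  intro x hx t ht
  rw [spaceDeriv_eq_fderiv hΩ.isOpen hx]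
  refine norm_fderiv_le_of_lip' ℝ hL0 ?_
  filter_upwards [hΩ.isOpen.mem_nhds hx] with y hy
  exact hlip y (subset_closure hy) x (subset_closure hx) t ht

theorem norm_spaceDeriv_lt (hm : 1 ≤ m) (hT : 0 < T) (hΩ : IsBoundedConvexC2Domain Ω)
    (hd : Metric.diam Ω ≤ d) (hd0 : 0 ≤ d)
    (hφ : IsParabolicC2 Ω T φ) (hu : IsSpacelikeGraphicMCF Ω T u)
    (hbdry : ∀ x ∈ frontier Ω, ∀ t ∈ Icc 0 T, u x t = φ x t)
    (hinit : ∀ x ∈ closure Ω, u x 0 = φ x 0) (hε : 0 < ε)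
    (hnorm : parabolicC2Norm Ω T φ < ENNReal.ofReal ε) {δ : ℝ} (hδ : δ ≤ gradientThreshold m)
    (hεd : (8 * (1 + 2 * m ^ 2) * d + 1) * ε < δ) :
    ∀ x ∈ closure Ω, ∀ t ∈ Icc 0 T, ‖spaceDeriv Ω u x t‖ < δ := by
  have hc := continuousOn_spaceDeriv hT hΩ hu.c1_closure
  have hS : IsCompact (closedCylinder Ω T) := hΩ.isBounded.isCompact_closure.prod isCompact_Icc
  set bad := closedCylinder Ω T ∩ (fun p => ‖spaceDeriv Ω u p.1 p.2‖) ⁻¹' Ici δ with hbad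
  have hbadc : IsCompact bad :=
    hS.of_isClosed_subset (hc.norm.preimage_isClosed_of_isClosed hS.isClosed isClosed_Ici)
      inter_subset_left
  intro a ha r hr
  by_contra! hcon
  -- Minimising time over the compact bad set gives the first time at which the gradient reaches
  -- `δ`.
  obtain ⟨⟨x, t⟩, ⟨⟨hx, ht⟩, hbig⟩, hmin⟩ :=
    hbadc.exists_isMinOn ⟨(a, r), ⟨ha, hr⟩, hcon⟩ continuous_snd.continuousOn
  simp only [mem_preimage, mem_Ici] at hx ht hbig
  have hbefore : ∀ y ∈ closure Ω, ∀ s ∈ Ico 0 t, ‖spaceDeriv Ω u y s‖ < δ := by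
    intro y hy s hs
    by_contra! h
    have := isMinOn_iff.1 hmin (y, s) ⟨⟨hy, hs.1, hs.2.le.trans ht.2⟩, h⟩
    exact hs.2.not_ge this
  have hεL : ε ≤ (8 * (1 + 2 * (m : ℝ) ^ 2) * d + 1) * ε := by
    have : 0 ≤ 8 * (1 + 2 * (m : ℝ) ^ 2) * d * ε := by positivity
    linarith
  have ht0 : 0 < t := by
    rcases ht.1.eq_or_lt with h | h
    · subst h
      have e : spaceDeriv Ω u x 0 = spaceDeriv Ω φ x 0 := fderivWithin_congr hinit (hinit x hx)
      rw [e] at hbig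
      linarith [(bounds_of_parabolicC2Norm_lt hε hnorm hx ht).1]
    · exact h
  have hint : ∀ y ∈ Ω, ∀ s ∈ Ioo 0 t,
      ‖spaceDeriv Ω u y s‖ ≤ (8 * (1 + 2 * m ^ 2) * d + 1) * ε := fun y hy s hs =>
    norm_spaceDeriv_le_of_small hm hΩ hd hd0 hφ hu hbdry hinit hε hnorm (hεd.le.trans hδ)
      ⟨hs.1, hs.2.trans_le ht.2⟩
      (fun z hz r hr => (hbefore z (subset_closure hz) r ⟨hr.1, hr.2.trans_lt hs.2⟩).le.trans hδ)
      y hy s ⟨hs.1.le, le_rfl⟩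
  -- The bad point may lie over `frontier Ω`, and the improved bound is known only over `Ω` before
  -- time `t`; it reaches the point by continuity.
  have hmem : (x, t) ∈ closure (Ω ×ˢ Ioo 0 t) := by
    rw [closure_prod_eq, closure_Ioo ht0.ne]
    exact ⟨hx, ht0.le, le_rfl⟩
  have hsub : Ω ×ˢ Ioo 0 t ⊆ closedCylinder Ω T := fun p hp =>
    ⟨subset_closure hp.1, hp.2.1.le, hp.2.2.le.trans ht.2⟩
  have hlim : Filter.Tendsto (fun p => ‖spaceDeriv Ω u p.1 p.2‖) (𝓝[Ω ×ˢ Ioo 0 t] (x, t))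
      (𝓝 ‖spaceDeriv Ω u x t‖) := (hc.norm (x, t) ⟨hx, ht⟩).mono hsub
  have := mem_closure_iff_nhdsWithin_neBot.1 hmem
  have hle := le_of_tendsto hlim (by
    filter_upwards [self_mem_nhdsWithin] with p hp using hint p.1 hp.1 p.2 hp.2)
  linarith

end Gradient

theorem mainTheorem5 (m : ℕ) (hm : 2 ≤ m) (κ : ℝ) (hκ : κ ∈ Ioo (0 : ℝ) 1) (d : ℝ) (hd : 0 < d) :
    ∃ ε : ℝ, 0 < ε ∧
      ∀ (n : ℕ), 1 ≤ n →
      ∀ (Ω : Set (EuclideanSpace ℝ (Fin m))), IsBoundedConvexC2Domain Ω → Metric.diam Ω ≤ d →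
      ∀ (T : ℝ), 0 < T →
      ∀ (φ u : EuclideanSpace ℝ (Fin m) → ℝ → EuclideanSpace ℝ (Fin n)),
        IsParabolicC2 Ω T φ →
        IsSpacelikeGraphicMCF Ω T u →
        (∀ x ∈ frontier Ω, ∀ t ∈ Icc 0 T, u x t = φ x t) →
        (∀ x ∈ closure Ω, u x 0 = φ x 0) →
        parabolicC2Norm Ω T φ < ENNReal.ofReal ε →
        ∀ t ∈ Icc 0 T, (⨆ x ∈ Ω, tripleNorm (spaceDeriv Ω u x t) ^ 2) < ENNReal.ofReal (1 - κ) := by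
  have hm1 : 1 ≤ m := by omega
  have hκ1 : 0 < 1 - κ := by linarith [hκ.2]
  have hthr := gradientThreshold_pos hm1
  set δ := min (gradientThreshold m) ((1 - κ) / 2) with hδ
  have hδ0 : 0 < δ := lt_min hthr (by linarith)
  have hδκ : δ ^ 2 < 1 - κ := by
    have h1 : δ ≤ (1 - κ) / 2 := min_le_right _ _
    nlinarith [hκ.1]
  have hC : 0 < 8 * (1 + 2 * (m : ℝ) ^ 2) * d + 1 := by positivity
  -- This `ε` makes the improved gradient bound equal to `δ / 2`.
  refine ⟨δ / 2 / (8 * (1 + 2 * (m : ℝ) ^ 2) * d + 1), by positivity, ?_⟩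
  intro n _ Ω hΩ hdiam T hT φ u hφ hu hbdry hinit hnorm t ht
  have hgrad := norm_spaceDeriv_lt hm1 hT hΩ hdiam hd.le hφ hu hbdry hinit (by positivity) hnorm
    (min_le_left _ _ : δ ≤ _) (by rw [mul_div_cancel₀ _ hC.ne']; linarith)
  refine lt_of_le_of_lt (iSup₂_le fun x hx => ?_)
    ((ENNReal.ofReal_lt_ofReal_iff hκ1).2 hδκ)
  rw [ENNReal.ofReal_pow hδ0.le]
  gcongr
  refine (tripleNorm_le _).trans ?_
  rw [← ofReal_norm]
  exact ENNReal.ofReal_le_ofReal (hgrad x (subset_closure hx) t ht).le
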